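/- Let $n$ be a natural number, $\mathfrak g=\mathfrak{sp}_{2n}(\mathbb C)\subset\mathfrak{gl}_{2n}(\mathbb C)$, and let $\theta\in\mathbb Q^n$ be a rational coweight of the diagonal maximal torus $T$ of $Sp_{2n}$ with $(\theta,\alpha_i)\ge 0$ for all simple roots $\alpha_i$ and $(\theta,\alpha_0)<1$ for the highest root $\alpha_0$. Let $P_\theta\subset Sp_{2n}(\mathbb C)$ be the parabolic subgroup generated by $T$ and the root subgroups $U_r$ with $(\theta,r)\ge 0$, $\mathfrak p_\theta$ its Lie algebra and $\mathfrak n_\theta$ the nilradical of $\mathfrak p_\theta$. Put $\widehat{\mathfrak p}_\theta=ev^{-1}(\mathfrak p_\theta)$, where $ev:\mathfrak g[[z]]\to\mathfrak g$ sets $z=0$, and $$\widehat{\mathfrak p}_\theta^\vee=\{u\in\mathfrak g((z)) : \kappa(u,v)\in\mathbb C[[z]]\ \text{ for all } v\in\widehat{\mathfrak p}_\theta\},$$ where $\kappa$ is the Killing form of $\mathfrak g$, extended $\mathbb C((z))$-bilinearly. Define $F_0,\dots,F_{2n}$ by $\det(M-T\cdot\mathrm{Id})=\sum_{j=0}^{2n}F_j(M)T^{2n-j}$.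 Let $O_\theta\subset\mathfrak n_\theta$ be the $P_\theta$-orbit that is open and dense in $\mathfrak n_\theta$ (the Richardson orbit), and let $\Lambda=(\lambda_1\ge\lambda_2\ge\cdots\ge\lambda_r)$ be the partition of $2n$ formed by the Jordan block sizes of its elements. For $1\le k\le 2n$ let $n(\Lambda,k)$ be the unique $a$ with $\lambda_1+\cdots+\lambda_{a-1}<k\le\lambda_1+\cdots+\lambda_a$. Then for every $\gamma\in\widehat{\mathfrak p}_\theta^\vee$ and every $1\le j\le n$, $$\nu(F_{2j}(\gamma))\ \ge\ -\bigl(2j-n(\Lambda,2j)\bigr),$$ where $\nu$ is the $z$-adic valuation on $\mathbb C((z))$, with $\nu(0)=\infty$. -/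

import Mathlib

open Matrix Polynomial

attribute [local instance 100] LieRing.ofAssociativeRing

noncomputable section

namespace SpParabolic

/-! ### Partitions -/

/-- The parts of a partition, listed in decreasing order. -/
def rows {m : ℕ} (Λ : m.Partition) : List ℕ := Λ.parts.sort (· ≥ ·)

/-- For a partition `Λ = (m₁ ≥ m₂ ≥ ⋯)` of `m` and `1 ≤ j ≤ m`, the number `n(Λ, j)` is the unique
`a` with `m₁ + ⋯ + m_{a-1} < j ≤ m₁ + ⋯ + m_a` (see `rowIndex_spec`, `rowIndex_unique`). -/
def rowIndex {m : ℕ} (Λ : m.Partition) (j : ℕ) : ℕ :=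
  sInf {a | 1 ≤ a ∧ ((rows Λ).take (a - 1)).sum < j ∧ j ≤ ((rows Λ).take a).sum}

theorem rowIndex_spec {m : ℕ} (Λ : m.Partition) (j : ℕ) (hj : 1 ≤ j) (hjm : j ≤ m) :
    1 ≤ rowIndex Λ j ∧ ((rows Λ).take (rowIndex Λ j - 1)).sum < j ∧
      j ≤ ((rows Λ).take (rowIndex Λ j)).sum := by
  have hex : ∃ a, j ≤ ((rows Λ).take a).sum := by
    refine ⟨(rows Λ).length, ?_⟩
    rw [List.take_length, rows, ← Multiset.sum_coe, Multiset.sort_eq, Λ.parts_sum]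
    exact hjm
  have hpos : 1 ≤ Nat.find hex := by
    by_contra h
    have h0 : Nat.find hex = 0 := by omega
    have := Nat.find_spec hex
    rw [h0] at this
    simp at this
    omega
  have hne : {a | 1 ≤ a ∧ ((rows Λ).take (a - 1)).sum < j ∧ j ≤ ((rows Λ).take a).sum}.Nonempty :=
    ⟨Nat.find hex, hpos, not_le.1 (Nat.find_min hex (by omega)), Nat.find_spec hex⟩
  exact Nat.sInf_mem hne

theorem rowIndex_unique {m : ℕ} (Λ : m.Partition) (j : ℕ) (hj : 1 ≤ j) (hjm : j ≤ m) (a : ℕ)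
    (h : ((rows Λ).take (a - 1)).sum < j) (h' : j ≤ ((rows Λ).take a).sum) :
    a = rowIndex Λ j := by
  obtain ⟨-, h1, h2⟩ := rowIndex_spec Λ j hj hjm
  have mono : ∀ b c : ℕ, b ≤ c → ((rows Λ).take b).sum ≤ ((rows Λ).take c).sum := fun b c hbc =>
    ((List.take_prefix_take_left hbc).sublist).sum_le_sum (by simp)
  rcases lt_trichotomy a (rowIndex Λ j) with hlt | heq | hgt
  · have := mono a (rowIndex Λ j - 1) (by omega)
    omega
  · exact heq
  · have := mono (rowIndex Λ j) (a - 1) (by omega)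
    omega

/-! ### Nilpotent matrices and their partitions -/

/-- The nilpotent Jordan block of size `k`. -/
def jordanBlock (k : ℕ) : Matrix (Fin k) (Fin k) ℂ :=
  Matrix.of fun a b => if (a : ℕ) + 1 = b then 1 else 0

/-- The block diagonal matrix whose blocks are nilpotent Jordan blocks of the given sizes. -/
def jordanMatrix (l : List ℕ) :
    Matrix (Σ i : Fin l.length, Fin (l.get i)) (Σ i : Fin l.length, Fin (l.get i)) ℂ :=
  Matrix.blockDiagonal' fun i => jordanBlock (l.get i)

/-- `e` is a nilpotent matrix whose Jordan normal form has blocks of sizes the parts of `Λ`. -/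
def HasPartition {ι : Type} [Fintype ι] [DecidableEq ι] {m : ℕ} (e : Matrix ι ι ℂ)
    (Λ : m.Partition) : Prop :=
  ∃ (σ : (Σ i : Fin (rows Λ).length, Fin ((rows Λ).get i)) ≃ ι) (g : GL ι ℂ),
    (g : Matrix ι ι ℂ) * e * ((g⁻¹ : GL ι ℂ) : Matrix ι ι ℂ) =
      Matrix.reindex σ σ (jordanMatrix (rows Λ))

/-- The coefficients of the characteristic polynomial, normalised by
`det (M - T) = ∑ j, F_j(M) T^(m - j)` for `M` of (even) size `m`. -/
def charCoeff {ι R : Type} [Fintype ι] [DecidableEq ι] [CommRing R] (j : ℕ) (M : Matrix ι ι R) : R :=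
  (M.map (C : R → R[X]) - (X : R[X]) • (1 : Matrix ι ι R[X])).det.coeff (Fintype.card ι - j)

/-! ### The parabolic subgroup attached to a rational coweight

The diagonal maximal torus of `Sp_{2n}` consists of the matrices `diag(t₁, …, t_n, t₁⁻¹, …, t_n⁻¹)`.
A rational coweight is a vector `θ ∈ ℚⁿ`. The simple roots are `ε_i - ε_{i+1}` and `2ε_n`, the
highest root is `2ε₁`, and the matrix entry at `(a, b)` lies in the weight space of
`ε_a - ε_b`, where `ε_{n+i} = -ε_i`. -/

/-- The coweights `θ` with `(θ, α) ≥ 0` for each simple root `α` and `(θ, α₀) < 1` for the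
highest root `α₀`. -/
def weylAlcove (n : ℕ) : Set (Fin n → ℚ) :=
  {θ | Antitone θ ∧ ∀ i, 0 ≤ 2 * θ i ∧ 2 * θ i < 1}

/-- The value `(θ, ε_a)`. -/
def coord {n : ℕ} (θ : Fin n → ℚ) : Fin n ⊕ Fin n → ℚ := Sum.elim θ fun i => -θ i

/-- The parabolic subgroup `P_θ` of `Sp_{2n}(ℂ)`, generated by the diagonal torus and the root
subgroups `U_r` with `(θ, r) ≥ 0`: the symplectic matrices whose entries of negative `θ`-weight
vanish. -/
def parabolicSubgroup {n : ℕ} (θ : Fin n → ℚ) : Subgroup (symplecticGroup (Fin n) ℂ) where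
  carrier := {g | ∀ a b, coord θ a - coord θ b < 0 → (g : Matrix _ _ ℂ) a b = 0}
  one_mem' := by
    intro a b h
    have : a ≠ b := by rintro rfl; simp at h
    simp [Matrix.one_apply_ne this]
  mul_mem' := by
    intro g h hg hh a b hab
    simp only [Submonoid.coe_mul, Matrix.mul_apply]
    refine Finset.sum_eq_zero fun c _ => ?_
    by_cases hac : coord θ a - coord θ c < 0
    · rw [hg a c hac, zero_mul]
    · rw [hh c b (by linarith), mul_zero]
  inv_mem' := by
    intro g hg a b hab
    have hg' : ∀ c d, coord θ c < coord θ d → (g : Matrix _ _ ℂ) c d = 0 := fun c d h =>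
      hg c d (by linarith)
    rw [SymplecticGroup.coe_inv]
    rcases a with a | a <;> rcases b with b | b <;>
      simp [Matrix.J, Matrix.mul_apply, Matrix.neg_apply, Matrix.one_apply] <;>
      refine hg' _ _ ?_ <;> simp [coord] at hab ⊢ <;> linarith

/-- The Lie algebra `𝔭_θ` of `P_θ`: the sum of the diagonal Cartan subalgebra and the root spaces
of `sp_{2n}` for the roots `r` with `(θ, r) ≥ 0`. -/
def parabolicSubalgebra {n : ℕ} (θ : Fin n → ℚ) :
    LieSubalgebra ℂ (Matrix (Fin n ⊕ Fin n) (Fin n ⊕ Fin n) ℂ) where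
  carrier := {M | M ∈ LieAlgebra.Symplectic.sp (Fin n) ℂ ∧
    ∀ a b, coord θ a - coord θ b < 0 → M a b = 0}
  add_mem' := by
    intro M N hM hN
    exact ⟨add_mem hM.1 hN.1, fun a b h => by simp [hM.2 a b h, hN.2 a b h]⟩
  zero_mem' := ⟨zero_mem _, fun a b _ => rfl⟩
  smul_mem' := by
    intro c M hM
    exact ⟨(LieAlgebra.Symplectic.sp (Fin n) ℂ).smul_mem c hM.1,
      fun a b h => by simp [hM.2 a b h]⟩
  lie_mem' := by
    intro M N hM hN
    refine ⟨LieSubalgebra.lie_mem _ hM.1 hN.1, fun a b h => ?_⟩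
    rw [Ring.lie_def, Matrix.sub_apply, Matrix.mul_apply, Matrix.mul_apply,
      Finset.sum_eq_zero, Finset.sum_eq_zero, sub_zero]
    all_goals
      intro c _
      by_cases hac : coord θ a - coord θ c < 0
    · rw [hN.2 a c hac, zero_mul]
    · rw [hM.2 c b (by linarith), mul_zero]
    · rw [hM.2 a c hac, zero_mul]
    · rw [hN.2 c b (by linarith), mul_zero]

/-- The largest nilpotent ideal of a finite-dimensional Lie algebra (ideals that are nilpotent as
Lie algebras in their own right). -/
def lieNilradical (L : Type) [LieRing L] [LieAlgebra ℂ L] : LieIdeal ℂ L :=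
  sSup {I : LieIdeal ℂ L | LieRing.IsNilpotent I}

/-- The nilradical `𝔫_θ` of `𝔭_θ`, as a set of matrices. -/
def parabolicNilradical {n : ℕ} (θ : Fin n → ℚ) :
    Set (Matrix (Fin n ⊕ Fin n) (Fin n ⊕ Fin n) ℂ) :=
  {M | ∃ h : M ∈ parabolicSubalgebra θ, (⟨M, h⟩ : parabolicSubalgebra θ) ∈
    lieNilradical (parabolicSubalgebra θ)}

/-! ### The Richardson orbit -/

/-- Zariski closed subsets of the affine space of matrices. -/
def IsZariskiClosed {ι : Type} (S : Set (Matrix ι ι ℂ)) : Prop :=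
  ∃ I : Ideal (MvPolynomial (ι × ι) ℂ),
    S = {M | (fun ab : ι × ι => M ab.1 ab.2) ∈ MvPolynomial.zeroLocus ℂ I}

/-- The orbit of a matrix under conjugation by `P_θ`. -/
def parabolicOrbit {n : ℕ} (θ : Fin n → ℚ) (e : Matrix (Fin n ⊕ Fin n) (Fin n ⊕ Fin n) ℂ) :
    Set (Matrix (Fin n ⊕ Fin n) (Fin n ⊕ Fin n) ℂ) :=
  {M | ∃ g ∈ parabolicSubgroup θ, M = (g : Matrix _ _ ℂ) * e *
    ((g⁻¹ : symplecticGroup (Fin n) ℂ) : Matrix _ _ ℂ)}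

/-- The dense open `P_θ`-orbit `O_θ` in `𝔫_θ`: the elements of `𝔫_θ` whose `P_θ`-orbit is Zariski
open and Zariski dense in `𝔫_θ`. -/
def richardsonOrbit {n : ℕ} (θ : Fin n → ℚ) :
    Set (Matrix (Fin n ⊕ Fin n) (Fin n ⊕ Fin n) ℂ) :=
  {e | e ∈ parabolicNilradical θ ∧
    (∃ S, IsZariskiClosed S ∧ parabolicOrbit θ e = parabolicNilradical θ \ S) ∧
    ∀ S, IsZariskiClosed S → parabolicOrbit θ e ⊆ S → parabolicNilradical θ ⊆ S}

/-! ### The parahoric subalgebra and its dual lattice -/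

/-- The parahoric subalgebra `ev⁻¹(𝔭_θ)` of `sp_{2n}((z))`, where `ev : sp_{2n}[[z]] → sp_{2n}` sets
`z = 0`. -/
def parahoric {n : ℕ} (θ : Fin n → ℚ) :
    Set (LieAlgebra.Symplectic.sp (Fin n) (LaurentSeries ℂ)) :=
  {v | ∃ w ∈ LieAlgebra.Symplectic.sp (Fin n) (PowerSeries ℂ),
    (v : Matrix _ _ (LaurentSeries ℂ)) = w.map (HahnSeries.ofPowerSeries ℤ ℂ) ∧
    w.map (PowerSeries.constantCoeff (R := ℂ)) ∈ parabolicSubalgebra θ}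

/-- The dual lattice of the parahoric subalgebra: the `u ∈ sp_{2n}((z))` with `κ(u, v) ∈ ℂ[[z]]` for
each `v` in the parahoric subalgebra, where `κ` is the Killing form, extended `ℂ((z))`-bilinearly. -/
def parahoricDual {n : ℕ} (θ : Fin n → ℚ) :
    Set (LieAlgebra.Symplectic.sp (Fin n) (LaurentSeries ℂ)) :=
  {u | ∀ v ∈ parahoric θ,
    killingForm (LaurentSeries ℂ) (LieAlgebra.Symplectic.sp (Fin n) (LaurentSeries ℂ)) u v ∈
      Set.range (HahnSeries.ofPowerSeries ℤ ℂ)}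

end SpParabolic

end

/-! Put A = zγ. The Killing form of sp_{2n} is (2n+2)·tr (`killingForm_sp`), so pairing γ with
symmetrised matrix units reads off its entries. Since z·g[[z]] lies in the parahoric, A has entries
in ℂ[[z]]. Pairing with units of nonnegative weight shows that A(0) has only entries of positive
weight, so A(0) lies in 𝔫_θ (`exists_powerSeries_of_mem_parahoricDual`).

It remains to see that z^{n(Λ,k)} divides F_k(A₀ + zB) for A₀ in 𝔫_θ; then F_{2j}(zγ) = z^{2j}
F_{2j}(γ) gives the bound. For fixed B this is a Zariski closed condition on A₀, so by density it
need only be checked on the Richardson orbit, and after conjugation on a Jordan matrix. There F_k is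
a signed sum over permutations of k-element index sets t. In every Jordan block met by t at least
one factor avoids the superdiagonal ones and is divisible by z (`card_blocks_le`). The blocks met
have total size at least k, so there are at least n(Λ,k) of them (`rowIndex_le_card`). -/

namespace SpParabolic

/-! ### Coefficients of the characteristic polynomial -/

section CharCoeff

variable {ι κ R S : Type} [Fintype ι] [DecidableEq ι] [Fintype κ] [DecidableEq κ]
  [CommRing R] [CommRing S]

/-- Leibniz expansion: `t` collects the columns where the entry of `M` is chosen over the `-T` of
the diagonal. -/
theorem charCoeff_eq_sum (j : ℕ) (M : Matrix ι ι R) :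
    charCoeff j M = ∑ σ : Equiv.Perm ι, Equiv.Perm.sign σ •
      ∑ t : Finset ι, if Fintype.card ι - j = (Finset.univ \ t).card then
        (∏ i ∈ t, M (σ i) i) * ∏ i ∈ Finset.univ \ t, -(1 : Matrix ι ι R) (σ i) i else 0 := by
  unfold charCoeff
  rw [Matrix.det_apply, Polynomial.finsetSum_coeff]
  refine Finset.sum_congr rfl fun σ _ => ?_
  have hent : ∀ i, (M.map (C : R → R[X]) - (X : R[X]) • (1 : Matrix ι ι R[X])) (σ i) i =
      C (M (σ i) i) + C (-(1 : Matrix ι ι R) (σ i) i) * X := by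
    intro i
    by_cases h : σ i = i
    · simp [Matrix.one_apply, h, sub_eq_add_neg]
    · simp [Matrix.one_apply_ne h]
  simp_rw [hent, Units.smul_def]
  rw [Polynomial.coeff_smul, Finset.prod_add, Polynomial.finsetSum_coeff, Finset.powerset_univ]
  congr 1
  refine Finset.sum_congr rfl fun t _ => ?_
  rw [Finset.prod_mul_distrib, Finset.prod_const, ← map_prod, ← map_prod, ← mul_assoc, ← C_mul,
    Polynomial.coeff_C_mul_X_pow]

theorem charCoeff_map (f : R →+* S) (j : ℕ) (M : Matrix ι ι R) :
    charCoeff j (M.map f) = f (charCoeff j M) := by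
  rw [charCoeff_eq_sum, charCoeff_eq_sum, map_sum]
  refine Finset.sum_congr rfl fun σ _ => ?_
  rw [Units.smul_def, Units.smul_def, map_zsmul, map_sum]
  congr 1
  refine Finset.sum_congr rfl fun t _ => ?_
  split_ifs
  · rw [map_mul, map_prod, map_prod]
    congr 1
    refine Finset.prod_congr rfl fun i _ => ?_
    by_cases h : σ i = i
    · simp [Matrix.one_apply, h]
    · simp [Matrix.one_apply_ne h]
  · simp

/-- The bound on `j` matters: by truncated subtraction, beyond the size of the matrix `charCoeff j`
is the determinant, of smaller degree. -/
theorem charCoeff_smul (c : R) {j : ℕ} (hj : j ≤ Fintype.card ι) (M : Matrix ι ι R) :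
    charCoeff j (c • M) = c ^ j * charCoeff j M := by
  rw [charCoeff_eq_sum, charCoeff_eq_sum, Finset.mul_sum]
  refine Finset.sum_congr rfl fun σ _ => ?_
  rw [mul_smul_comm, Finset.mul_sum]
  congr 1
  refine Finset.sum_congr rfl fun t _ => ?_
  split_ifs with h
  · have ht : t.card = j := by
      have h1 := Finset.card_sdiff_add_card_eq_card (Finset.subset_univ t)
      rw [Finset.card_univ] at h1
      omega
    simp only [Matrix.smul_apply, smul_eq_mul, Finset.prod_mul_distrib, Finset.prod_const, ht]
    ring
  · simp

theorem charCoeff_conj (j : ℕ) (M P Q : Matrix ι ι R) (h : P * Q = 1) :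
    charCoeff j (P * M * Q) = charCoeff j M := by
  unfold charCoeff
  have hPQ : P.map (C : R →+* R[X]) * Q.map (C : R →+* R[X]) = 1 := by
    rw [← Matrix.map_mul, h, Matrix.map_one _ (map_zero _) (map_one _)]
  have : (P * M * Q).map (C : R → R[X]) - (X : R[X]) • (1 : Matrix ι ι R[X]) =
      P.map (C : R →+* R[X]) * (M.map (C : R → R[X]) - (X : R[X]) • (1 : Matrix ι ι R[X])) *
        Q.map (C : R →+* R[X]) := by
    rw [mul_sub, sub_mul, mul_smul_comm, mul_one, smul_mul_assoc, hPQ]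
    congr 1
    exact (Matrix.map_mul (f := (C : R →+* R[X]))).trans (by rw [Matrix.map_mul])
  rw [this, Matrix.det_mul, Matrix.det_mul, mul_right_comm, ← Matrix.det_mul, hPQ, Matrix.det_one,
    one_mul]

theorem charCoeff_reindex (j : ℕ) (e : ι ≃ κ) (M : Matrix ι ι R) :
    charCoeff j (Matrix.reindex e e M) = charCoeff j M := by
  unfold charCoeff
  have : (Matrix.reindex e e M).map (C : R → R[X]) - (X : R[X]) • (1 : Matrix κ κ R[X]) =
      Matrix.reindex e e (M.map (C : R → R[X]) - (X : R[X]) • (1 : Matrix ι ι R[X])) := by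
    ext1 a b
    simp [Matrix.one_apply]
  rw [this, Matrix.det_reindex_self, Fintype.card_congr e]

end CharCoeff

/-! ### Sums of parts of a partition -/

theorem sum_le_sum_take_of_sublist {l' l : List ℕ} (h : l'.Sublist l) (hl : l.Pairwise (· ≥ ·)) :
    l'.sum ≤ (l.take l'.length).sum := by
  induction h with
  | slnil => simp
  | @cons l₁ l₂ a h ih =>
    refine (ih hl.of_cons).trans ?_
    -- Prepending a larger head cannot lower the sum of the first `k` terms; this absorbs an element
    -- skipped by the sublist.
    have key : ∀ (k a : ℕ) (l : List ℕ), (a :: l).Pairwise (· ≥ ·) →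
        (l.take k).sum ≤ ((a :: l).take k).sum := by
      intro k
      induction k with
      | zero => simp
      | succ k ih' =>
        intro a l hl
        cases l with
        | nil => simp
        | cons b l =>
          have := ih' b l hl.of_cons
          have hab : b ≤ a := (List.pairwise_cons.1 hl).1 b (by simp)
          simp only [List.take_succ_cons, List.sum_cons] at this ⊢
          omega
    exact key _ _ _ hl
  | @cons_cons l₁ l₂ a h ih =>
    simpa using ih hl.of_cons

theorem sum_get_le_sum_take {l : List ℕ} (hl : l.Pairwise (· ≥ ·)) (s : Finset (Fin l.length)) :
    ∑ i ∈ s, l.get i ≤ (l.take s.card).sum := by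
  have h1 : (((List.finRange l.length).filter (· ∈ s)).map l.get).Sublist l := by
    have := (List.filter_sublist (p := fun i => decide (i ∈ s))
      (l := List.finRange l.length)).map l.get
    simpa using this
  have hnd : ((List.finRange l.length).filter (· ∈ s)).Nodup :=
    (List.nodup_finRange _).filter _
  have hs : ((List.finRange l.length).filter (· ∈ s)).toFinset = s := by
    ext; simp
  have h2 := sum_le_sum_take_of_sublist h1 hl
  rw [List.length_map, ← List.toFinset_card_of_nodup hnd, ← List.sum_toFinset _ hnd, hs] at h2
  exact h2

/-- Fewer parts than `rowIndex Λ k` sum to at most the first `rowIndex Λ k - 1` parts, hence to less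
than `k`. -/
theorem rowIndex_le_card {m : ℕ} (Λ : m.Partition) {k : ℕ} (hk : 1 ≤ k) (hkm : k ≤ m)
    (s : Finset (Fin (rows Λ).length)) (hs : k ≤ ∑ i ∈ s, (rows Λ).get i) :
    rowIndex Λ k ≤ s.card := by
  by_contra! hlt
  obtain ⟨-, h, -⟩ := rowIndex_spec Λ k hk hkm
  have h1 := sum_get_le_sum_take (l := rows Λ) (by exact Multiset.pairwise_sort _ _) s
  have h2 : ((rows Λ).take s.card).sum ≤ ((rows Λ).take (rowIndex Λ k - 1)).sum :=
    ((List.take_prefix_take_left (by omega)).sublist).sum_le_sum (by simp)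
  omega

/-! ### Perturbations of nilpotent matrices -/

theorem of_jordanMatrix_ne_zero {l : List ℕ} {p q : Σ i : Fin l.length, Fin (l.get i)}
    (h : jordanMatrix l p q ≠ 0) : p.1 = q.1 ∧ (p.2 : ℕ) + 1 = q.2 := by
  obtain ⟨i, x⟩ := p
  obtain ⟨j, y⟩ := q
  by_cases hij : i = j
  · subst hij
    refine ⟨rfl, ?_⟩
    by_contra hxy
    exact h (by simp [jordanMatrix, Matrix.blockDiagonal'_apply_eq, jordanBlock] at hxy ⊢; exact hxy)
  · exact absurd (by rw [jordanMatrix, Matrix.blockDiagonal'_apply_ne _ _ _ hij]) h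

/-- In each block met by `t`, the element `q` of `t` in lowest position has a zero entry: a nonzero
one would put `σ q` just before `q` in that block, which minimality forbids inside `t` and
injectivity of `σ` forbids outside. -/
theorem card_blocks_le {l : List ℕ} (σ : Equiv.Perm (Σ i : Fin l.length, Fin (l.get i)))
    (t : Finset (Σ i : Fin l.length, Fin (l.get i))) (ht : ∀ p, p ∉ t → σ p = p) :
    (t.image Sigma.fst).card ≤ (t.filter fun p => jordanMatrix l (σ p) p = 0).card := by
  refine le_trans (Finset.card_le_card ?_) (Finset.card_image_le (f := Sigma.fst))
  intro i hi
  obtain ⟨p, hp, hpi⟩ := Finset.mem_image.1 hi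
  obtain ⟨q, hq, hmin⟩ := Finset.exists_min_image (t.filter fun q => q.1 = i)
    (fun q => (q.2 : ℕ)) ⟨p, Finset.mem_filter.2 ⟨hp, hpi⟩⟩
  obtain ⟨hqt, hqi⟩ := Finset.mem_filter.1 hq
  refine Finset.mem_image.2 ⟨q, Finset.mem_filter.2 ⟨hqt, ?_⟩, hqi⟩
  by_contra hne
  obtain ⟨h1, h2⟩ := of_jordanMatrix_ne_zero hne
  by_cases hσ : σ q ∈ t
  · have := hmin (σ q) (Finset.mem_filter.2 ⟨hσ, h1.trans hqi⟩)
    omega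
  · have := σ.injective (ht _ hσ)
    rw [this] at h2
    omega

theorem X_pow_dvd_charCoeff_jordanMatrix {m : ℕ} (Λ : m.Partition) {k : ℕ} (hk : 1 ≤ k)
    (hkm : k ≤ m)
    (B : Matrix (Σ i : Fin (rows Λ).length, Fin ((rows Λ).get i))
      (Σ i : Fin (rows Λ).length, Fin ((rows Λ).get i)) (PowerSeries ℂ)) :
    (PowerSeries.X : PowerSeries ℂ) ^ rowIndex Λ k ∣
      charCoeff k ((jordanMatrix (rows Λ)).map (PowerSeries.C (R := ℂ)) +
        (PowerSeries.X : PowerSeries ℂ) • B) := by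
  have hcard : Fintype.card (Σ i : Fin (rows Λ).length, Fin ((rows Λ).get i)) = m := by
    rw [Fintype.card_sigma]
    simp only [Fintype.card_fin]
    have : ∑ i, (rows Λ).get i = (rows Λ).sum := by
      rw [← List.sum_ofFn, List.ofFn_get]
    rw [this, rows, ← Multiset.sum_coe, Multiset.sort_eq, Λ.parts_sum]
  rw [charCoeff_eq_sum]
  refine Finset.dvd_sum fun σ _ => ?_
  rw [Units.smul_def]
  rw [zsmul_eq_mul]
  refine Dvd.dvd.mul_left (Finset.dvd_sum fun t _ => ?_) _
  split_ifs with h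
  swap
  · exact dvd_zero _
  -- If `σ` moves a point outside `t`, the term contains an off-diagonal entry of the identity.
  by_cases hfix : ∀ p, p ∉ t → σ p = p
  swap
  · push Not at hfix
    obtain ⟨p, hp, hσ⟩ := hfix
    rw [Finset.prod_eq_zero (i := p) (s := Finset.univ \ t) (by simp [hp])
      (by rw [Matrix.one_apply_ne hσ, neg_zero]), mul_zero]
    exact dvd_zero _
  refine Dvd.dvd.mul_right ?_ _
  have htk : t.card = k := by
    have h1 := Finset.card_sdiff_add_card_eq_card (Finset.subset_univ t)
    rw [Finset.card_univ] at h1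
    omega
  have hsum : k ≤ ∑ i ∈ t.image Sigma.fst, (rows Λ).get i := by
    have hsub : t ⊆ (t.image Sigma.fst).sigma fun _ => Finset.univ := fun p hp => by
      simpa using ⟨p.2, hp⟩
    have := Finset.card_le_card hsub
    rw [Finset.card_sigma, htk] at this
    simpa using this
  have hle := (rowIndex_le_card Λ hk hkm _ hsum).trans (card_blocks_le σ t hfix)
  -- Where the Jordan entry is zero, the factor is `X` times an entry of `B`.
  rw [← Finset.prod_filter_mul_prod_filter_not t (fun p => jordanMatrix (rows Λ) (σ p) p = 0)]
  refine Dvd.dvd.mul_right ((pow_dvd_pow _ hle).trans ?_) _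
  rw [← Finset.prod_const]
  refine Finset.prod_dvd_prod_of_dvd _ _ fun p hp => ?_
  simp [(Finset.mem_filter.1 hp).2]

variable {ι : Type} [Fintype ι] [DecidableEq ι]

/-- Conjugating `e` to Jordan form only replaces `B` by another power series matrix, and the Jordan
case allows any `B`. -/
theorem HasPartition.X_pow_dvd_charCoeff {m : ℕ} {Λ : m.Partition} {e : Matrix ι ι ℂ}
    (he : HasPartition e Λ) {k : ℕ} (hk : 1 ≤ k) (hkm : k ≤ m) (B : Matrix ι ι (PowerSeries ℂ)) :
    (PowerSeries.X : PowerSeries ℂ) ^ rowIndex Λ k ∣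
      charCoeff k (e.map (PowerSeries.C (R := ℂ)) + (PowerSeries.X : PowerSeries ℂ) • B) := by
  obtain ⟨σ, g, h⟩ := he
  set P := (g : Matrix ι ι ℂ).map (PowerSeries.C (R := ℂ))
  set Q := ((g⁻¹ : GL ι ℂ) : Matrix ι ι ℂ).map (PowerSeries.C (R := ℂ))
  have hPQ : P * Q = 1 := by
    rw [← Matrix.map_mul, Units.mul_inv, Matrix.map_one _ (map_zero _) (map_one _)]
  rw [← charCoeff_conj k _ P Q hPQ, ← charCoeff_reindex k σ.symm]
  convert X_pow_dvd_charCoeff_jordanMatrix Λ hk hkm (Matrix.reindex σ.symm σ.symm (P * B * Q))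
    using 2
  have h' : P * e.map (PowerSeries.C (R := ℂ)) * Q =
      (Matrix.reindex σ σ (jordanMatrix (rows Λ))).map (PowerSeries.C (R := ℂ)) := by
    rw [← h, Matrix.map_mul, Matrix.map_mul]
  rw [mul_add, add_mul, h', mul_smul_comm, smul_mul_assoc]
  ext1 a b
  simp

theorem HasPartition.conj {m : ℕ} {Λ : m.Partition} {e : Matrix ι ι ℂ} (he : HasPartition e Λ)
    (u : GL ι ℂ) :
    HasPartition ((u : Matrix ι ι ℂ) * e * ((u⁻¹ : GL ι ℂ) : Matrix ι ι ℂ)) Λ := by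
  obtain ⟨σ, g, h⟩ := he
  refine ⟨σ, g * u⁻¹, ?_⟩
  rw [← h]
  have h1 : ((u⁻¹ : GL ι ℂ) : Matrix ι ι ℂ) * (u : Matrix ι ι ℂ) = 1 := Units.inv_mul u
  simp only [_root_.mul_inv_rev, inv_inv, Units.val_mul]
  calc _ = (g : Matrix ι ι ℂ) * (((u⁻¹ : GL ι ℂ) : Matrix ι ι ℂ) * (u : Matrix ι ι ℂ)) * e *
        (((u⁻¹ : GL ι ℂ) : Matrix ι ι ℂ) * (u : Matrix ι ι ℂ)) *
          ((g⁻¹ : GL ι ℂ) : Matrix ι ι ℂ) := by noncomm_ring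
    _ = _ := by rw [h1, mul_one, mul_one]

theorem HasPartition.of_mem_parabolicOrbit {n m : ℕ} {Λ : m.Partition} {θ : Fin n → ℚ}
    {e M : Matrix (Fin n ⊕ Fin n) (Fin n ⊕ Fin n) ℂ} (he : HasPartition e Λ)
    (hM : M ∈ parabolicOrbit θ e) : HasPartition M Λ := by
  obtain ⟨g, -, rfl⟩ := hM
  let u : GL (Fin n ⊕ Fin n) ℂ := ⟨g, ((g⁻¹ : symplecticGroup (Fin n) ℂ) : Matrix _ _ ℂ),
    congrArg Subtype.val (mul_inv_cancel g), congrArg Subtype.val (inv_mul_cancel g)⟩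
  exact he.conj u

/-! ### Passing to the closure of the orbit -/

theorem isZariskiClosed_X_pow_dvd_charCoeff (k a : ℕ) (B : Matrix ι ι (PowerSeries ℂ)) :
    IsZariskiClosed {M : Matrix ι ι ℂ | (PowerSeries.X : PowerSeries ℂ) ^ a ∣
      charCoeff k (M.map (PowerSeries.C (R := ℂ)) + (PowerSeries.X : PowerSeries ℂ) • B)} := by
  -- The generic matrix plus `X • B`: the power series coefficients of its `charCoeff` are
  -- polynomials in the entries of `M`, and those of index below `a` cut out the set.
  let G : Matrix ι ι (PowerSeries (MvPolynomial (ι × ι) ℂ)) :=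
    Matrix.of (fun p q => PowerSeries.C (MvPolynomial.X (p, q))) +
      (PowerSeries.X : PowerSeries (MvPolynomial (ι × ι) ℂ)) •
        B.map (PowerSeries.map (MvPolynomial.C (σ := ι × ι) (R := ℂ)))
  have hG : ∀ (M : Matrix ι ι ℂ) (i : ℕ),
      MvPolynomial.eval (fun ab : ι × ι => M ab.1 ab.2) (PowerSeries.coeff i (charCoeff k G)) =
        PowerSeries.coeff i (charCoeff k (M.map (PowerSeries.C (R := ℂ)) +
          (PowerSeries.X : PowerSeries ℂ) • B)) := by
    intro M i
    rw [← PowerSeries.coeff_map, ← charCoeff_map]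
    congr 2
    ext1 p q
    have hB : PowerSeries.map (MvPolynomial.eval fun ab : ι × ι => M ab.1 ab.2)
        (PowerSeries.map (MvPolynomial.C (σ := ι × ι) (R := ℂ)) (B p q)) = B p q := by
      ext; simp
    simp [G, hB]
  refine ⟨Ideal.span ((fun i => PowerSeries.coeff i (charCoeff k G)) '' {i | i < a}), ?_⟩
  ext M
  rw [Set.mem_ofPred_eq, Set.mem_ofPred_eq, MvPolynomial.zeroLocus_span, PowerSeries.X_pow_dvd_iff]
  simp only [Set.mem_ofPred_eq, Set.forall_mem_image]
  refine forall₂_congr fun i _ => ?_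
  rw [← hG]
  rfl

theorem X_pow_dvd_charCoeff_of_mem_parabolicNilradical {n m : ℕ} {θ : Fin n → ℚ}
    {Λ : m.Partition} (hΛ : ∃ e ∈ richardsonOrbit θ, HasPartition e Λ) {k : ℕ} (hk : 1 ≤ k)
    (hkm : k ≤ m) (A : Matrix (Fin n ⊕ Fin n) (Fin n ⊕ Fin n) (PowerSeries ℂ))
    (hA : A.map (PowerSeries.constantCoeff (R := ℂ)) ∈ parabolicNilradical θ) :
    (PowerSeries.X : PowerSeries ℂ) ^ rowIndex Λ k ∣ charCoeff k A := by
  obtain ⟨e, ⟨-, -, hdense⟩, he⟩ := hΛ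
  -- The higher-order part of `A`, divided by `X`, is frozen while the constant term varies over the
  -- nilradical.
  let B : Matrix (Fin n ⊕ Fin n) (Fin n ⊕ Fin n) (PowerSeries ℂ) :=
    Matrix.of fun a b => PowerSeries.mk fun p => PowerSeries.coeff (p + 1) (A a b)
  have h := hdense _ (isZariskiClosed_X_pow_dvd_charCoeff k (rowIndex Λ k) B)
    (fun M hM => (he.of_mem_parabolicOrbit hM).X_pow_dvd_charCoeff hk hkm B) hA
  rw [Set.mem_ofPred_eq] at h
  convert h using 2
  ext1 a b
  rw [PowerSeries.eq_X_mul_shift_add_const (A a b)]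
  simp [B, add_comm]

/-! ### Traces of endomorphisms of the space of matrices -/

section Trace

variable {ι R : Type} [Fintype ι] [DecidableEq ι] [CommRing R]

theorem trace_end_matrix (f : Matrix ι ι R →ₗ[R] Matrix ι ι R) :
    LinearMap.trace R _ f = ∑ a, ∑ b, f (Matrix.single a b 1) a b := by
  rw [LinearMap.trace_eq_matrix_trace R (Matrix.stdBasis R ι ι), Matrix.trace,
    Fintype.sum_prod_type]
  refine Finset.sum_congr rfl fun a _ => Finset.sum_congr rfl fun b _ => ?_
  rw [Matrix.diag_apply, LinearMap.toMatrix_apply, Matrix.stdBasis_eq_single]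
  rfl

/-- The map `X ↦ P X Q`. -/
def mulLeftRight (P Q : Matrix ι ι R) : Matrix ι ι R →ₗ[R] Matrix ι ι R :=
  LinearMap.mulRight R Q ∘ₗ LinearMap.mulLeft R P

/-- The map `X ↦ P Xᵀ Q`. -/
def mulTransposeMul (P Q : Matrix ι ι R) : Matrix ι ι R →ₗ[R] Matrix ι ι R :=
  mulLeftRight P Q ∘ₗ (Matrix.transposeLinearEquiv ι ι R R).toLinearMap

@[simp]
theorem mulLeftRight_apply (P Q M : Matrix ι ι R) : mulLeftRight P Q M = P * M * Q := rfl

@[simp]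
theorem mulTransposeMul_apply (P Q M : Matrix ι ι R) : mulTransposeMul P Q M = P * Mᵀ * Q := rfl

theorem mul_single_mul_apply (P Q : Matrix ι ι R) (a b c d : ι) :
    (P * Matrix.single a b (1 : R) * Q) c d = P c a * Q b d := by
  rw [Matrix.mul_apply, Finset.sum_eq_single b]
  · simp
  · intro x _ hx
    rw [Matrix.mul_single_apply_of_ne _ _ _ _ _ hx, zero_mul]
  · simp

theorem trace_mulLeftRight (P Q : Matrix ι ι R) :
    LinearMap.trace R _ (mulLeftRight P Q) = P.trace * Q.trace := by
  rw [trace_end_matrix, Matrix.trace, Matrix.trace, Finset.sum_mul_sum]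
  simp [mul_single_mul_apply]

theorem trace_mulTransposeMul (P Q : Matrix ι ι R) :
    LinearMap.trace R _ (mulTransposeMul P Q) = (P * Qᵀ).trace := by
  rw [trace_end_matrix]
  simp only [mulTransposeMul_apply, Matrix.transpose_single, mul_single_mul_apply]
  simp only [Matrix.trace, Matrix.diag_apply, Matrix.mul_apply, Matrix.transpose_apply]

end Trace

/-! ### The symplectic involution -/

section Involution

variable {l R : Type} [Fintype l] [DecidableEq l] [CommRing R]

/-- The involution of `gl_{2n}` whose fixed points are `sp_{2n}`. -/
def symplecticInvolution : Matrix (l ⊕ l) (l ⊕ l) R →ₗ[R] Matrix (l ⊕ l) (l ⊕ l) R :=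
  mulTransposeMul (Matrix.J l R) (Matrix.J l R)

theorem symplecticInvolution_apply (M : Matrix (l ⊕ l) (l ⊕ l) R) :
    symplecticInvolution M = Matrix.J l R * Mᵀ * Matrix.J l R := rfl

theorem J_mul_J_mul (M : Matrix (l ⊕ l) (l ⊕ l) R) : Matrix.J l R * (Matrix.J l R * M) = -M := by
  rw [← Matrix.mul_assoc, Matrix.J_squared, neg_mul, one_mul]

theorem mem_sp_iff {M : Matrix (l ⊕ l) (l ⊕ l) R} :
    M ∈ LieAlgebra.Symplectic.sp l R ↔ symplecticInvolution M = M := by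
  rw [LieAlgebra.Symplectic.sp, mem_skewAdjointMatricesLieSubalgebra,
    mem_skewAdjointMatricesSubmodule, Matrix.IsSkewAdjoint, Matrix.IsAdjointPair,
    symplecticInvolution_apply]
  constructor
  · intro h
    rw [Matrix.mul_assoc, h, Matrix.mul_neg, Matrix.mul_neg, J_mul_J_mul, neg_neg]
  · intro h
    have := congrArg (fun N => Matrix.J l R * N) h
    simp only [Matrix.mul_assoc, J_mul_J_mul] at this
    rw [Matrix.mul_neg, ← this, neg_neg]

theorem symplecticInvolution_symplecticInvolution (M : Matrix (l ⊕ l) (l ⊕ l) R) :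
    symplecticInvolution (symplecticInvolution M) = M := by
  simp only [symplecticInvolution_apply, Matrix.transpose_mul, Matrix.J_transpose,
    Matrix.transpose_transpose, Matrix.mul_assoc, Matrix.neg_mul, Matrix.mul_neg,
    Matrix.J_squared, J_mul_J_mul, Matrix.mul_one, neg_neg]

theorem add_symplecticInvolution_mem_sp (M : Matrix (l ⊕ l) (l ⊕ l) R) :
    M + symplecticInvolution M ∈ LieAlgebra.Symplectic.sp l R := by
  rw [mem_sp_iff, map_add, symplecticInvolution_symplecticInvolution, add_comm]

theorem trace_symplecticInvolution (M : Matrix (l ⊕ l) (l ⊕ l) R) :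
    (symplecticInvolution M).trace = -M.trace := by
  rw [symplecticInvolution_apply, Matrix.trace_mul_comm, J_mul_J_mul, Matrix.trace_neg,
    Matrix.trace_transpose]

/-- For `u` in sp the trace pairing sees only the sp-component of `M`. -/
theorem trace_mul_symplecticInvolution {u : Matrix (l ⊕ l) (l ⊕ l) R}
    (hu : u ∈ LieAlgebra.Symplectic.sp l R) (M : Matrix (l ⊕ l) (l ⊕ l) R) :
    (u * symplecticInvolution M).trace = (u * M).trace := by
  have h : Matrix.J l R * u * Matrix.J l R = uᵀ := by
    have := congrArg Matrix.transpose (mem_sp_iff.1 hu)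
    simpa [symplecticInvolution_apply, Matrix.J_transpose, Matrix.mul_assoc] using this
  rw [symplecticInvolution_apply, ← Matrix.mul_assoc, Matrix.trace_mul_comm, ← Matrix.mul_assoc,
    ← Matrix.mul_assoc, h, ← Matrix.transpose_mul, Matrix.trace_transpose, Matrix.trace_mul_comm]

theorem symplecticInvolution_map {S : Type} [CommRing S] (f : R →+* S)
    (M : Matrix (l ⊕ l) (l ⊕ l) R) :
    symplecticInvolution (M.map f) = (symplecticInvolution M).map f := by
  simp only [symplecticInvolution_apply, Matrix.map_mul, Matrix.transpose_map]
  rw [Matrix.map_J]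

end Involution

/-! ### The Killing form of the symplectic Lie algebra -/

section Killing

variable {l K : Type} [Fintype l] [DecidableEq l] [Field K]

/-- With the projection `(1 + symplecticInvolution) / 2`, the trace over sp becomes a trace over gl.
With n = card l, the untransposed terms contribute 4n·tr(uv), the four transposed ones tr(uv) each;
half the total is (2n+2)·tr(uv). -/
theorem killingForm_sp (h2 : (2 : K) ≠ 0) (u v : LieAlgebra.Symplectic.sp l K) :
    killingForm K (LieAlgebra.Symplectic.sp l K) u v =
      (2 * Fintype.card l + 2) * ((u : Matrix (l ⊕ l) (l ⊕ l) K) * (v : Matrix _ _ K)).trace := by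
  let inc : LieAlgebra.Symplectic.sp l K →ₗ[K] Matrix (l ⊕ l) (l ⊕ l) K :=
    (LieAlgebra.Symplectic.sp l K).toSubmodule.subtype
  let proj : Matrix (l ⊕ l) (l ⊕ l) K →ₗ[K] LieAlgebra.Symplectic.sp l K :=
    LinearMap.codRestrict (LieAlgebra.Symplectic.sp l K).toSubmodule
      ((2 : K)⁻¹ • (LinearMap.id + symplecticInvolution))
      (fun M => (LieAlgebra.Symplectic.sp l K).smul_mem _ (add_symplecticInvolution_mem_sp M))
  have hproj : proj ∘ₗ inc = LinearMap.id := by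
    ext1 x
    apply Subtype.ext
    change (2 : K)⁻¹ • ((x : Matrix (l ⊕ l) (l ⊕ l) K) +
      symplecticInvolution (x : Matrix (l ⊕ l) (l ⊕ l) K)) = (x : Matrix (l ⊕ l) (l ⊕ l) K)
    rw [mem_sp_iff.1 x.2, ← two_smul K, smul_smul, inv_mul_cancel₀ h2, one_smul]
  obtain ⟨u, hu⟩ := u
  obtain ⟨v, hv⟩ := v
  -- `ad u ∘ ad v` on all of gl, expanded.
  let F : Matrix (l ⊕ l) (l ⊕ l) K →ₗ[K] Matrix (l ⊕ l) (l ⊕ l) K :=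
    mulLeftRight (u * v) 1 - mulLeftRight u v - mulLeftRight v u + mulLeftRight 1 (v * u)
  rw [killingForm_apply_apply]
  have hF : inc ∘ₗ (LieAlgebra.ad K (LieAlgebra.Symplectic.sp l K) ⟨u, hu⟩ ∘ₗ
      LieAlgebra.ad K (LieAlgebra.Symplectic.sp l K) ⟨v, hv⟩) = F ∘ₗ inc := by
    ext1 x
    obtain ⟨x, hx⟩ := x
    change u * (v * x - x * v) - (v * x - x * v) * u =
      u * v * x * 1 - u * x * v - v * x * u + 1 * x * (v * u)
    noncomm_ring
  have hcomp : (LieAlgebra.ad K (LieAlgebra.Symplectic.sp l K) ⟨u, hu⟩ ∘ₗ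
      LieAlgebra.ad K (LieAlgebra.Symplectic.sp l K) ⟨v, hv⟩) = proj ∘ₗ (F ∘ₗ inc) := by
    rw [← hF, ← LinearMap.comp_assoc, hproj, LinearMap.id_comp]
  have hgl : (F ∘ₗ inc) ∘ₗ proj = (2 : K)⁻¹ • (F + (mulTransposeMul (u * v * J l K) (J l K) -
      mulTransposeMul (u * J l K) (J l K * v) - mulTransposeMul (v * J l K) (J l K * u) +
      mulTransposeMul (J l K) (J l K * (v * u)))) := by
    ext1 M
    change F ((2 : K)⁻¹ • (M + J l K * Mᵀ * J l K)) = (2 : K)⁻¹ • (F M +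
      (u * v * J l K * Mᵀ * J l K - u * J l K * Mᵀ * (J l K * v) -
        v * J l K * Mᵀ * (J l K * u) + J l K * Mᵀ * (J l K * (v * u))))
    rw [map_smul, map_add]
    congr 2
    change u * v * (J l K * Mᵀ * J l K) * 1 - u * (J l K * Mᵀ * J l K) * v -
      v * (J l K * Mᵀ * J l K) * u + 1 * (J l K * Mᵀ * J l K) * (v * u) = _
    noncomm_ring
  have hJJ : ∀ M : Matrix (l ⊕ l) (l ⊕ l) K, J l K * (Mᵀ * J l K) = symplecticInvolution M :=
    fun M => by rw [symplecticInvolution_apply, Matrix.mul_assoc]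
  -- Tracelessness removes the `tr u * tr v` terms.
  have htu : ∀ w ∈ LieAlgebra.Symplectic.sp l K, w.trace = 0 := fun w hw => by
    have h := trace_symplecticInvolution w
    rw [mem_sp_iff.1 hw] at h
    have : 2 * w.trace = 0 := by linear_combination h
    exact (mul_eq_zero.1 this).resolve_left h2
  rw [hcomp, LinearMap.trace_comp_comm', hgl]
  simp only [F, map_smul, map_add, map_sub, trace_mulLeftRight, trace_mulTransposeMul,
    Matrix.transpose_mul, Matrix.J_transpose, Matrix.mul_neg, Matrix.trace_neg, Matrix.mul_assoc,
    Matrix.J_squared, hJJ, mem_sp_iff.1 hu, mem_sp_iff.1 hv, htu u hu, htu v hv,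
    Matrix.trace_one, smul_eq_mul]
  have hlast : (J l K * (uᵀ * (vᵀ * J l K))).trace = -(u * v).trace := by
    rw [Matrix.trace_mul_comm, Matrix.mul_assoc, Matrix.mul_assoc, Matrix.J_squared]
    rw [Matrix.mul_neg, Matrix.mul_neg, Matrix.trace_neg, Matrix.mul_one, ← Matrix.transpose_mul,
      Matrix.trace_transpose, Matrix.trace_mul_comm]
  rw [hlast, Matrix.trace_mul_comm v u]
  simp only [Matrix.mul_one, neg_neg, Fintype.card_sum, Nat.cast_add]
  field_simp
  ring

end Killing

/-! ### The nilradical of the parabolic subalgebra -/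

section Nilradical

variable {ι R : Type} [Fintype ι] [DecidableEq ι] [CommRing R]

theorem isNilpotent_of_strictlyPositive {w : ι → ℚ} {M : Matrix ι ι R}
    (hM : ∀ a b, w a ≤ w b → M a b = 0) : IsNilpotent M := by
  -- Nonzero entries of `M` strictly lower the weight from row to column, so a path starting at `a`
  -- is no longer than the number of indices of weight below `w a`.
  have key : ∀ (k : ℕ) (a b : ι), (Finset.univ.filter fun c => w c < w a).card < k →
      (M ^ k) a b = 0 := by
    intro k
    induction k with
    | zero => intro a b h; omega
    | succ k ih =>
      intro a b h
      rw [pow_succ', Matrix.mul_apply]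
      refine Finset.sum_eq_zero fun c _ => ?_
      by_cases hac : w a ≤ w c
      · rw [hM a c hac, zero_mul]
      · rw [ih c b, mul_zero]
        refine lt_of_lt_of_le (Finset.card_lt_card ⟨fun d hd => ?_, fun hsub => ?_⟩)
          (Nat.lt_succ_iff.1 h)
        · simp only [Finset.mem_filter, Finset.mem_univ, true_and] at hd ⊢
          exact hd.trans (not_le.1 hac)
        · simpa using hsub (Finset.mem_filter.2 ⟨Finset.mem_univ c, not_le.1 hac⟩)
  refine ⟨Fintype.card ι + 1, ?_⟩
  ext a b
  exact key _ a b (Nat.lt_succ_of_le (Finset.card_le_univ _))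

end Nilradical

/-- The elements of `𝔭_θ` whose entries of non-positive `θ`-weight vanish. -/
def positiveIdeal {n : ℕ} (θ : Fin n → ℚ) : LieIdeal ℂ (parabolicSubalgebra θ) where
  carrier := {M | ∀ a b, coord θ a ≤ coord θ b → (M : Matrix _ _ ℂ) a b = 0}
  add_mem' := by
    intro M N hM hN a b h
    change (M : Matrix _ _ ℂ) a b + (N : Matrix _ _ ℂ) a b = 0
    rw [hM a b h, hN a b h, add_zero]
  zero_mem' := fun a b _ => rfl
  smul_mem' := by
    intro c M hM a b h
    change c * (M : Matrix _ _ ℂ) a b = 0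
    rw [hM a b h, mul_zero]
  lie_mem := by
    rintro ⟨M, hM⟩ ⟨N, hN'⟩ hN a b h
    change ∀ a b, coord θ a ≤ coord θ b → N a b = 0 at hN
    change (M * N - N * M) a b = 0
    rw [Matrix.sub_apply, Matrix.mul_apply, Matrix.mul_apply, Finset.sum_eq_zero,
      Finset.sum_eq_zero, sub_zero]
    all_goals
      intro c _
    · by_cases hac : coord θ a ≤ coord θ c
      · rw [hN a c hac, zero_mul]
      · rw [hM.2 c b (by linarith), mul_zero]
    · by_cases hac : coord θ a - coord θ c < 0
      · rw [hM.2 a c hac, zero_mul]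
      · rw [hN c b (by linarith), mul_zero]

/-- Engel's theorem: each element is a nilpotent matrix, hence ad-nilpotent. -/
theorem isNilpotent_positiveIdeal {n : ℕ} (θ : Fin n → ℚ) :
    LieRing.IsNilpotent (positiveIdeal θ) := by
  rw [LieAlgebra.isNilpotent_iff_forall (R := ℂ)]
  intro x
  have hx : IsNilpotent ((x : parabolicSubalgebra θ) : Matrix (Fin n ⊕ Fin n) (Fin n ⊕ Fin n) ℂ) :=
    isNilpotent_of_strictlyPositive (w := coord θ) x.2
  obtain ⟨k, hk⟩ := LieAlgebra.isNilpotent_ad_of_isNilpotent (R := ℂ) (x := x.1) hx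
  refine ⟨k, ?_⟩
  ext1 y
  apply Subtype.ext
  have h : ∀ (j : ℕ) (y : positiveIdeal θ),
      (((LieAlgebra.ad ℂ (positiveIdeal θ) x) ^ j) y : parabolicSubalgebra θ) =
        ((LieAlgebra.ad ℂ (parabolicSubalgebra θ) x.1) ^ j) y := by
    intro j
    induction j with
    | zero => intro y; rfl
    | succ j ih =>
      intro y
      rw [pow_succ, pow_succ, Module.End.mul_apply, Module.End.mul_apply, ih]
      rfl
  rw [h, hk]
  rfl

theorem mem_parabolicNilradical {n : ℕ} {θ : Fin n → ℚ}
    {M : Matrix (Fin n ⊕ Fin n) (Fin n ⊕ Fin n) ℂ} (hM : M ∈ LieAlgebra.Symplectic.sp (Fin n) ℂ)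
    (h : ∀ a b, coord θ a ≤ coord θ b → M a b = 0) : M ∈ parabolicNilradical θ :=
  ⟨⟨hM, fun a b hab => h a b (by linarith)⟩,
    (le_sSup (show positiveIdeal θ ∈ {I : LieIdeal ℂ (parabolicSubalgebra θ) |
      LieRing.IsNilpotent I} from isNilpotent_positiveIdeal θ) : positiveIdeal θ ≤ _) h⟩

/-! ### The dual lattice of the parahoric subalgebra -/

section DualLattice

variable {n : ℕ} {θ : Fin n → ℚ}

/-- Up to sign the involution swaps entries of equal `θ`-weight. -/
theorem symplecticInvolution_apply_eq_zero {R : Type} [CommRing R]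
    {M : Matrix (Fin n ⊕ Fin n) (Fin n ⊕ Fin n) R}
    (hM : ∀ a b, coord θ a - coord θ b < 0 → M a b = 0) (a b : Fin n ⊕ Fin n)
    (hab : coord θ a - coord θ b < 0) : symplecticInvolution M a b = 0 := by
  have hM' : ∀ c d, coord θ c < coord θ d → M c d = 0 := fun c d h => hM c d (by linarith)
  rw [symplecticInvolution_apply]
  rcases a with a | a <;> rcases b with b | b <;>
    simp [Matrix.J, Matrix.mul_apply, Matrix.neg_apply, Matrix.one_apply] <;>
    refine hM' _ _ ?_ <;> simp [coord] at hab ⊢ <;> linarith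

theorem trace_mul_smul_single {l R : Type} [Fintype l] [DecidableEq l] [CommRing R]
    {u : Matrix (l ⊕ l) (l ⊕ l) R} (hu : u ∈ LieAlgebra.Symplectic.sp l R) (a b : l ⊕ l) (c : R) :
    (u * c • (Matrix.single a b 1 + symplecticInvolution (Matrix.single a b 1))).trace =
      2 * c * u b a := by
  rw [mul_smul_comm, mul_add, Matrix.trace_smul, Matrix.trace_add,
    trace_mul_symplecticInvolution hu, Matrix.trace_mul_single, smul_eq_mul]
  simp
  ring

/-- The test element is `c` times a symmetrised matrix unit at `(a, b)`. Either hypothesis puts it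
in the parahoric: its value at z = 0 vanishes or has nonnegative weight. -/
theorem mem_range_ofPowerSeries_of_mem_parahoricDual
    {γ : LieAlgebra.Symplectic.sp (Fin n) (LaurentSeries ℂ)} (hγ : γ ∈ parahoricDual θ)
    (a b : Fin n ⊕ Fin n) (c : PowerSeries ℂ)
    (h : PowerSeries.constantCoeff c = 0 ∨ coord θ b ≤ coord θ a) :
    ∃ f : PowerSeries ℂ, HahnSeries.ofPowerSeries ℤ ℂ f =
      HahnSeries.ofPowerSeries ℤ ℂ c *
        (γ : Matrix (Fin n ⊕ Fin n) (Fin n ⊕ Fin n) (LaurentSeries ℂ)) b a := by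
  obtain ⟨γ, hsp⟩ := γ
  let w : Matrix (Fin n ⊕ Fin n) (Fin n ⊕ Fin n) (PowerSeries ℂ) :=
    c • (Matrix.single a b 1 + symplecticInvolution (Matrix.single a b 1))
  have hw : w ∈ LieAlgebra.Symplectic.sp (Fin n) (PowerSeries ℂ) :=
    (LieAlgebra.Symplectic.sp (Fin n) (PowerSeries ℂ)).smul_mem c
      (add_symplecticInvolution_mem_sp _)
  have hmap : ∀ {S : Type} [CommRing S] (f : PowerSeries ℂ →+* S),
      w.map f = f c • (Matrix.single a b 1 + symplecticInvolution (Matrix.single a b 1)) := by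
    intro S _ f
    have h1 : (Matrix.single a b (1 : PowerSeries ℂ)).map f = Matrix.single a b 1 := by
      rw [Matrix.map_single, map_one]
    rw [← h1, symplecticInvolution_map]
    ext1 p q
    simp only [w, Matrix.map_apply, Matrix.smul_apply, Matrix.add_apply, smul_eq_mul, map_mul,
      map_add]
  have hwsp : ∀ {S : Type} [CommRing S] (f : PowerSeries ℂ →+* S),
      w.map f ∈ LieAlgebra.Symplectic.sp (Fin n) S := by
    intro S _ f
    rw [mem_sp_iff, symplecticInvolution_map, mem_sp_iff.1 hw]
  have hpar : w.map (PowerSeries.constantCoeff (R := ℂ)) ∈ parabolicSubalgebra θ := by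
    refine ⟨hwsp _, fun p q hpq => ?_⟩
    rw [hmap]
    rcases h with h | h
    · rw [h, zero_smul, Matrix.zero_apply]
    · have hs : ∀ p q, coord θ p - coord θ q < 0 → Matrix.single a b (1 : ℂ) p q = 0 := by
        intro p q hpq
        refine Matrix.single_apply_of_ne _ _ _ _ _ ?_
        rintro ⟨rfl, rfl⟩
        linarith
      rw [Matrix.smul_apply, Matrix.add_apply, hs p q hpq,
        symplecticInvolution_apply_eq_zero hs p q hpq, add_zero, smul_zero]
  obtain ⟨f, hf⟩ := hγ ⟨w.map (HahnSeries.ofPowerSeries ℤ ℂ), hwsp _⟩ ⟨w, hw, rfl, hpar⟩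
  have hC : ∀ k : ℂ, k ≠ 0 → HahnSeries.ofPowerSeries ℤ ℂ (PowerSeries.C k) ≠ 0 := fun k hk =>
    (map_ne_zero_iff _ HahnSeries.ofPowerSeries_injective).2
      ((map_ne_zero_iff _ PowerSeries.C_injective).2 hk)
  have h2 : (2 : LaurentSeries ℂ) ≠ 0 := by
    simpa only [map_ofNat] using hC 2 two_ne_zero
  rw [killingForm_sp h2] at hf
  dsimp only at hf
  rw [hmap, trace_mul_smul_single hsp, Fintype.card_fin] at hf
  have hk : (2 * (2 * n + 2) : ℂ) ≠ 0 := by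
    exact_mod_cast (by omega : 2 * (2 * n + 2) ≠ 0)
  -- The pairing equals 2(2n+2)·c·γ_{ba}: `2n + 2` from the Killing form, `2` from the
  -- symmetrisation.
  refine ⟨PowerSeries.C (2 * (2 * n + 2) : ℂ)⁻¹ * f, ?_⟩
  have hinv : HahnSeries.ofPowerSeries ℤ ℂ (PowerSeries.C (2 * (2 * n + 2) : ℂ)⁻¹) *
      (2 * (2 * n + 2)) = 1 := by
    have := congrArg (fun k => HahnSeries.ofPowerSeries ℤ ℂ (PowerSeries.C k))
      (inv_mul_cancel₀ hk)
    simpa only [map_mul, map_add, map_one, map_ofNat, map_natCast] using this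
  rw [map_mul, hf]
  linear_combination (HahnSeries.ofPowerSeries ℤ ℂ c * γ b a) * hinv

theorem exists_powerSeries_of_mem_parahoricDual
    {γ : LieAlgebra.Symplectic.sp (Fin n) (LaurentSeries ℂ)} (hγ : γ ∈ parahoricDual θ) :
    ∃ A : Matrix (Fin n ⊕ Fin n) (Fin n ⊕ Fin n) (PowerSeries ℂ),
      A.map (HahnSeries.ofPowerSeries ℤ ℂ) =
        HahnSeries.ofPowerSeries ℤ ℂ PowerSeries.X •
          (γ : Matrix (Fin n ⊕ Fin n) (Fin n ⊕ Fin n) (LaurentSeries ℂ)) ∧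
      A.map (PowerSeries.constantCoeff (R := ℂ)) ∈ parabolicNilradical θ := by
  choose A hA using fun b a => mem_range_ofPowerSeries_of_mem_parahoricDual hγ a b PowerSeries.X
    (Or.inl PowerSeries.constantCoeff_X)
  have hmap : (Matrix.of A).map (HahnSeries.ofPowerSeries ℤ ℂ) =
      HahnSeries.ofPowerSeries ℤ ℂ PowerSeries.X •
        (γ : Matrix (Fin n ⊕ Fin n) (Fin n ⊕ Fin n) (LaurentSeries ℂ)) := by
    ext1 b a
    exact hA b a
  refine ⟨Matrix.of A, hmap, mem_parabolicNilradical ?_ fun b a hba => ?_⟩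
  · have : Matrix.of A ∈ LieAlgebra.Symplectic.sp (Fin n) (PowerSeries ℂ) := by
      rw [mem_sp_iff]
      apply Matrix.map_injective (HahnSeries.ofPowerSeries_injective (Γ := ℤ) (R := ℂ))
      change (symplecticInvolution (Matrix.of A)).map (HahnSeries.ofPowerSeries ℤ ℂ) =
        (Matrix.of A).map (HahnSeries.ofPowerSeries ℤ ℂ)
      rw [← symplecticInvolution_map, hmap, map_smul, mem_sp_iff.1 γ.2]
    rw [mem_sp_iff, symplecticInvolution_map, mem_sp_iff.1 this]
  -- With `c = 1` the entry of γ itself is integral, so that of zγ has no constant term.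
  · obtain ⟨f, hf⟩ := mem_range_ofPowerSeries_of_mem_parahoricDual hγ a b 1 (Or.inr hba)
    have : A b a = PowerSeries.X * f := by
      apply HahnSeries.ofPowerSeries_injective (Γ := ℤ) (R := ℂ)
      rw [hA, map_mul, hf, map_one, one_mul]
    simp [this]

end DualLattice

end SpParabolic

theorem lemma4 (n : ℕ) (θ : Fin n → ℚ) (hθ : θ ∈ SpParabolic.weylAlcove n)
    (Λ : (2 * n).Partition)
    (hΛ : ∃ e ∈ SpParabolic.richardsonOrbit θ, SpParabolic.HasPartition e Λ)
    (γ : LieAlgebra.Symplectic.sp (Fin n) (LaurentSeries ℂ))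
    (hγ : γ ∈ SpParabolic.parahoricDual θ)
    (j : ℕ) (hj : 1 ≤ j) (hjn : j ≤ n) :
    ((-(2 * (j : ℤ) - (SpParabolic.rowIndex Λ (2 * j) : ℤ)) : ℤ) : WithTop ℤ) ≤
      (SpParabolic.charCoeff (2 * j)
        (γ : Matrix (Fin n ⊕ Fin n) (Fin n ⊕ Fin n) (LaurentSeries ℂ))).orderTop := by
  obtain ⟨A, hA, hnil⟩ := SpParabolic.exists_powerSeries_of_mem_parahoricDual hγ
  obtain ⟨f, hf⟩ := SpParabolic.X_pow_dvd_charCoeff_of_mem_parabolicNilradical hΛ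
    (k := 2 * j) (by omega) (by omega) A hnil
  have h := SpParabolic.charCoeff_map (HahnSeries.ofPowerSeries ℤ ℂ) (2 * j) A
  rw [hA, SpParabolic.charCoeff_smul _ (by simp; omega), hf, map_mul, map_pow,
    HahnSeries.ofPowerSeries_X, HahnSeries.single_pow, HahnSeries.single_pow] at h
  set F := SpParabolic.charCoeff (2 * j)
    (γ : Matrix (Fin n ⊕ Fin n) (Fin n ⊕ Fin n) (LaurentSeries ℂ))
  -- Dividing F_{2j}(zγ) = z^{2j} F_{2j}(γ) by z^{2j}.
  have hF : F = HahnSeries.single (-(2 * (j : ℤ) - (SpParabolic.rowIndex Λ (2 * j) : ℤ)))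
      (1 : ℂ) * HahnSeries.ofPowerSeries ℤ ℂ f := by
    have h' := congrArg (fun G => HahnSeries.single (-(2 * (j : ℤ))) (1 : ℂ) * G) h
    simp only [← mul_assoc, HahnSeries.single_mul_single, one_pow, mul_one] at h'
    convert h' using 2
    · simp
    · congr 1
      simp
      ring_nf
  have hf0 : (0 : WithTop ℤ) ≤ (HahnSeries.ofPowerSeries ℤ ℂ f).orderTop := by
    rw [HahnSeries.le_orderTop_iff_forall]
    intro i hi
    rw [HahnSeries.ofPowerSeries_apply]
    refine HahnSeries.embDomain_of_notMem_range ?_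
    rintro ⟨k, rfl⟩
    have : ((k : ℤ) : WithTop ℤ) < 0 := hi
    norm_cast at this
  rw [hF, HahnSeries.orderTop_mul, HahnSeries.orderTop_single one_ne_zero]
  exact le_add_of_nonneg_right hf0
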